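/- Let $n \ge 0$, let $-\infty \le a \le b \le +\infty$, and let $\phi_1,\dots,\phi_{2n},\psi_1,\dots,\psi_{2n}$ be real- or complex-valued functions of one real variable that are Lebesgue integrable on the real points of $[a,b]$. For $x=(x_1,\dots,x_{2n})$ let $(\phi_i(x_j)\,|\,\psi_i(x_j))$ denote the $2n\times 2n$ matrix whose $i$th row is $$[\phi_i(x_1),\ \psi_i(x_2),\ \phi_i(x_3),\ \psi_i(x_4),\ \dots,\ \phi_i(x_{2n-1}),\ \psi_i(x_{2n})],$$ and for $1\le i,j\le 2n$ put $$Q_{ij}=\iint_{a\le x<y\le b}\bigl[\phi_i(x)\psi_j(y)-\phi_j(x)\psi_i(y)\bigr]\,dx\,dy .$$ Then the integrals defining the $Q_{ij}$ and the integral on the left below converge absolutely, and $$\int\!\cdots\!\int_{a\le x_1<\cdots<x_{2n}\le b}\det\bigl(\phi_i(x_j)\,|\,\psi_i(x_j)\bigr)\,dx_1\cdots dx_{2n}=\mathrm{Pf}\,(Q_{ij})_{1\le i,j\le 2n}.$$ Here the Pfaffian of an antisymmetric $2n\times 2n$ matrix $A$ is $\mathrm{Pf}(A)=\sum \varepsilon\,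 a_{i_1j_1}\cdots a_{i_nj_n}$, summed over all decompositions of $\{1,\dots,2n\}$ into pairs $\{i_k,j_k\}$ with $i_k<j_k$ and $i_1<\cdots<i_n$, where $\varepsilon$ is the signature of the permutation $i_1j_1\cdots i_nj_n$ (for $n=0$ both sides equal $1$). -/

import Mathlib

open MeasureTheory

/-- The index `2k - 1` (for `k = 1, …, n`) of `{1, …, 2n}`, in zero-based numbering. -/
def pairFst {n : ℕ} (k : Fin n) : Fin (2 * n) := ⟨2 * (k : ℕ), by omega⟩

/-- The index `2k` (for `k = 1, …, n`) of `{1, …, 2n}`, in zero-based numbering. -/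
def pairSnd {n : ℕ} (k : Fin n) : Fin (2 * n) := ⟨2 * (k : ℕ) + 1, by omega⟩

/-- Permutations `i₁ j₁ i₂ j₂ … iₙ jₙ` with `i₁ < i₂ < … < iₙ` and `iₖ < jₖ` for all `k`.
Each decomposition of the index set into pairs is listed exactly once. -/
def pairings (n : ℕ) : Finset (Equiv.Perm (Fin (2 * n))) :=
  Finset.univ.filter fun σ =>
    (∀ k : Fin n, σ (pairFst k) < σ (pairSnd k)) ∧
      (∀ k l : Fin n, k < l → σ (pairFst k) < σ (pairFst l))

/-- The Pfaffian of a matrix of order `2n` (used for antisymmetric matrices): the signed sum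
of `a_{i₁j₁} ⋯ a_{iₙjₙ}` over all decompositions of the index set into pairs. -/
def pfaffian {R : Type*} [CommRing R] {n : ℕ} (A : Matrix (Fin (2 * n)) (Fin (2 * n)) R) : R :=
  ∑ σ ∈ pairings n, ((Equiv.Perm.sign σ : ℤ) : R) *
    ∏ k : Fin n, A (σ (pairFst k)) (σ (pairSnd k))

/-- The real points of the interval `[a, b]`; the endpoints may be infinite. -/
def realInterval (a b : EReal) : Set ℝ := {t | a ≤ (t : EReal) ∧ (t : EReal) ≤ b}

/-- The domain `a ≤ x₁ < x₂ < ⋯ < xₘ ≤ b` in `ℝᵐ`. -/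
def orderedDomain (a b : EReal) (m : ℕ) : Set (Fin m → ℝ) :=
  {x | StrictMono x ∧ ∀ j, x j ∈ realInterval a b}

/-- The domain `a ≤ x < y ≤ b` in `ℝ²`. -/
def triangleDomain (a b : EReal) : Set (ℝ × ℝ) :=
  {p | p.1 ∈ realInterval a b ∧ p.2 ∈ realInterval a b ∧ p.1 < p.2}

/-- The matrix whose `i`th row is `[φᵢ(x₁), ψᵢ(x₂), …, φᵢ(x₂ₙ₋₁), ψᵢ(x₂ₙ)]`
(columns are numbered from zero, so the `φ`-columns are the even ones). -/
def alternatingMatrix {K : Type*} {n : ℕ} (φ ψ : Fin (2 * n) → ℝ → K) (x : Fin (2 * n) → ℝ) :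
    Matrix (Fin (2 * n)) (Fin (2 * n)) K :=
  Matrix.of fun i j => if Even (j : ℕ) then φ i (x j) else ψ i (x j)

/-- The matrix `Q` with entries `∬_{a ≤ x < y ≤ b} [φᵢ(x) ψⱼ(y) - φⱼ(x) ψᵢ(y)] dx dy`. -/
noncomputable def pairIntegralMatrix {K : Type*} [RCLike K] {n : ℕ} (a b : EReal)
    (φ ψ : Fin (2 * n) → ℝ → K) : Matrix (Fin (2 * n)) (Fin (2 * n)) K :=
  Matrix.of fun i j =>
    ∫ p in triangleDomain a b, (φ i p.1 * ψ j p.2 - φ j p.1 * ψ i p.2)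

/-!
Write `p k` and `q k` for the coordinates with the indices `2k - 1` and `2k`, so that `φ` is
evaluated at the points `p k` and `ψ` at the points `q k`. The determinant `D` of the alternating
matrix is alternating in the `p`'s and, separately, in the `q`'s. The formula follows by integrating
`D` over the larger region `p k < q k` for all `k`, in two ways.

* On that region the pairs `(p k, q k)` are independent of each other. Expanding `D` by Leibniz
  turns the integral into an alternating sum, over all listings of the indices, of products of
  double integrals `M i j = ∬_{x < y} φᵢ(x) ψⱼ(y)` (`integral_det_mul_pairsOrdered`). Each
  decomposition into pairs is listed `n!` times with its pairs permuted, and exchanging the members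
  of a pair replaces `M` by `M - Mᵀ = Q`; so this sum is `n! * Pf Q` (`sum_sign_mul_prod_pairs_eq`).
* Since `D` is alternating, only the alternating sum of the weight `∏ k, 1[p k < q k]` over the
  permutations of the `p`'s and of the `q`'s matters (`integral_mul_alternatingSum`). This sum is
  `n!` times the determinant of the zero-one matrix `1[p i < q j]`. For sorted `p` and `q` that
  matrix is a staircase, and its determinant is `1` if `p 1 < q 1 < p 2 < q 2 < ⋯` and `0` otherwise
  (`det_comparisonMatrix_of_strictMono`). Hence the weight may be replaced by `n!` times the
  indicator function of the ordered domain (`alternatingSum_pairsOrdered_eq`). Points with equal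
  coordinates have to be excluded here; they are negligible because the measure has no atoms.

The argument is carried out for an arbitrary σ-finite measure without atoms on the line, and
applied to Lebesgue measure restricted to the real points of `[a, b]`.
-/

/-! ### Listings of the indices and the Pfaffian -/

/-- The numbering of the `2n` indices by `n` consecutive pairs: in zero-based terms,
`(k, c) ↦ 2k + c`. -/
def pairIndex (n : ℕ) : Fin n × Fin 2 ≃ Fin (2 * n) :=
  finProdFinEquiv.trans (finCongr (Nat.mul_comm n 2))

@[simp] lemma pairIndex_zero {n : ℕ} (k : Fin n) : pairIndex n (k, 0) = pairFst k := by
  ext; simp [pairIndex, pairFst]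

@[simp] lemma pairIndex_one {n : ℕ} (k : Fin n) : pairIndex n (k, 1) = pairSnd k := by
  ext; simp [pairIndex, pairSnd]; omega

lemma pairIndex_symm_pairFst {n : ℕ} (k : Fin n) : (pairIndex n).symm (pairFst k) = (k, 0) := by
  rw [← pairIndex_zero, Equiv.symm_apply_apply]

lemma pairIndex_symm_pairSnd {n : ℕ} (k : Fin n) : (pairIndex n).symm (pairSnd k) = (k, 1) := by
  rw [← pairIndex_one, Equiv.symm_apply_apply]

lemma prod_univ_eq_prod_pairs {M : Type*} [CommMonoid M] {n : ℕ} (f : Fin (2 * n) → M) :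
    ∏ i, f i = ∏ k : Fin n, f (pairFst k) * f (pairSnd k) := by
  rw [← (pairIndex n).prod_comp, Fintype.prod_prod_type]
  simp [Fin.prod_univ_two]

lemma forall_index_iff {n : ℕ} {P : Fin (2 * n) → Prop} :
    (∀ i, P i) ↔ (∀ k : Fin n, P (pairFst k)) ∧ ∀ k : Fin n, P (pairSnd k) := by
  rw [← (pairIndex n).forall_congr_right]
  simp [Prod.forall, Fin.forall_fin_two, forall_and]

/-- The permutation that moves the pairs by `ρ` and rearranges inside the pair `k` by `s k`. -/
def wreathPerm {n : ℕ} (ρ : Equiv.Perm (Fin n)) (s : Fin n → Equiv.Perm (Fin 2)) :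
    Equiv.Perm (Fin (2 * n)) :=
  (pairIndex n).permCongr (Equiv.prodCongrLeft (fun _ : Fin 2 => ρ) * Equiv.prodCongrRight s)

lemma wreathPerm_apply {n : ℕ} (ρ : Equiv.Perm (Fin n)) (s : Fin n → Equiv.Perm (Fin 2))
    (k : Fin n) (c : Fin 2) :
    wreathPerm ρ s (pairIndex n (k, c)) = pairIndex n (ρ k, s k c) := by
  simp [wreathPerm, Equiv.prodCongrLeft, Equiv.prodCongrRight]

lemma sign_wreathPerm {n : ℕ} (ρ : Equiv.Perm (Fin n)) (s : Fin n → Equiv.Perm (Fin 2)) :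
    Equiv.Perm.sign (wreathPerm ρ s) = ∏ k, Equiv.Perm.sign (s k) := by
  rw [wreathPerm, Equiv.Perm.sign_permCongr, Equiv.Perm.sign_mul, Equiv.Perm.sign_prodCongrLeft,
    Equiv.Perm.sign_prodCongrRight]
  simp

lemma wreathPerm_inv_apply {n : ℕ} (ρ : Equiv.Perm (Fin n)) (s : Fin n → Equiv.Perm (Fin 2))
    (k : Fin n) (c : Fin 2) :
    (wreathPerm ρ s)⁻¹ (pairIndex n (k, c)) =
      pairIndex n (ρ⁻¹ k, (s (ρ⁻¹ k))⁻¹ c) := by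
  rw [Equiv.Perm.inv_eq_iff_eq, wreathPerm_apply]
  simp

/-- An injective family indexed by `Fin n` is sorted by exactly one permutation. -/
lemma existsUnique_strictMono_comp {α : Type*} [LinearOrder α] {n : ℕ} {f : Fin n → α}
    (hf : Function.Injective f) : ∃! ρ : Equiv.Perm (Fin n), StrictMono (f ∘ ρ) := by
  refine ⟨Tuple.sort f, (Tuple.monotone_sort f).strictMono_of_injective
    (hf.comp (Equiv.injective _)), fun ρ hρ => ?_⟩
  have h := Tuple.unique_monotone hρ.monotone (Tuple.monotone_sort f)
  ext k
  exact congrArg _ (hf (congrFun h k))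

lemma existsUnique_perm_two {α : Type*} [LinearOrder α] {f : Fin 2 → α}
    (hf : Function.Injective f) : ∃! t : Equiv.Perm (Fin 2), f (t 0) < f (t 1) := by
  obtain ⟨t, ht, ht'⟩ := existsUnique_strictMono_comp hf
  refine ⟨t, ht (by decide : (0 : Fin 2) < 1), fun u hu => ht' u ?_⟩
  change StrictMono (f ∘ u)
  rw [Fin.strictMono_iff_lt_succ]
  intro i
  fin_cases i
  exact hu

/-- Every listing of the indices comes in exactly one way from a decomposition into pairs,
by ordering the pairs and ordering each pair. -/
lemma existsUnique_mul_wreathPerm_inv_mem_pairings {n : ℕ} (σ : Equiv.Perm (Fin (2 * n))) :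
    ∃! h : Equiv.Perm (Fin n) × (Fin n → Equiv.Perm (Fin 2)),
      σ * (wreathPerm h.1 h.2)⁻¹ ∈ pairings n := by
  have hinj (k : Fin n) : Function.Injective fun c : Fin 2 => σ (pairIndex n (k, c)) :=
    fun c d h => by simpa using h
  choose t ht ht' using fun k => existsUnique_perm_two (hinj k)
  have hinj' : Function.Injective fun k => σ (pairIndex n (k, t k 0)) :=
    fun k l h => by simpa using congrArg Prod.fst ((pairIndex n).injective (σ.injective h))
  obtain ⟨ρ, hρ, hρ'⟩ := existsUnique_strictMono_comp hinj'
  -- membership in `pairings`, read off the pair numbers `ρ⁻¹ k`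
  have key (h : Equiv.Perm (Fin n) × (Fin n → Equiv.Perm (Fin 2))) :
      σ * (wreathPerm h.1 h.2)⁻¹ ∈ pairings n ↔
        (∀ k, σ (pairIndex n (k, (h.2 k)⁻¹ 0)) < σ (pairIndex n (k, (h.2 k)⁻¹ 1))) ∧
        StrictMono ((fun k => σ (pairIndex n (k, (h.2 k)⁻¹ 0))) ∘ ⇑h.1⁻¹) := by
    simp only [pairings, Finset.mem_filter, Finset.mem_univ, true_and, ← pairIndex_zero,
      ← pairIndex_one, Equiv.Perm.mul_apply, wreathPerm_inv_apply]
    refine and_congr ?_ Iff.rfl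
    exact h.1⁻¹.forall_congr_right
      (q := fun k => σ (pairIndex n (k, (h.2 k)⁻¹ 0)) < σ (pairIndex n (k, (h.2 k)⁻¹ 1)))
  refine ⟨(ρ⁻¹, fun k => (t k)⁻¹), ?_, ?_⟩
  · refine (key _).2 ?_
    simpa using ⟨ht, hρ⟩
  · rintro ⟨ρ₂, s⟩ h
    replace h := (key _).1 h
    have hs : ∀ k, (s k)⁻¹ = t k := fun k => ht' k _ (h.1 k)
    have h2 := h.2
    simp only [hs] at h2
    have := hρ' _ h2
    ext1
    · simp [← this]
    · funext k
      simp [← hs]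

/-- Summing over the orders of the pairs and inside the pairs: the full alternating sum over
all listings is `n!` times the Pfaffian of the antisymmetrised matrix. -/
theorem sum_sign_mul_prod_pairs_eq {R : Type*} [CommRing R] {n : ℕ}
    (M : Matrix (Fin (2 * n)) (Fin (2 * n)) R) :
    ∑ σ : Equiv.Perm (Fin (2 * n)), ((Equiv.Perm.sign σ : ℤ) : R) *
        ∏ k : Fin n, M (σ (pairFst k)) (σ (pairSnd k)) =
      n.factorial * pfaffian (M - M.transpose) := by
  classical
  set f : Equiv.Perm (Fin (2 * n)) → R := fun σ => ((Equiv.Perm.sign σ : ℤ) : R) *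
        ∏ k : Fin n, M (σ (pairFst k)) (σ (pairSnd k)) with hf
  have hpair (i : Fin n → Fin 2 → Fin (2 * n)) :
      ∑ s : Fin n → Equiv.Perm (Fin 2), ∏ k, (((Equiv.Perm.sign (s k) : ℤ) : R) *
        M (i k (s k 0)) (i k (s k 1))) =
      ∏ k, (M - M.transpose) (i k 0) (i k 1) := by
    rw [← Fintype.prod_sum (fun k (u : Equiv.Perm (Fin 2)) => ((Equiv.Perm.sign u : ℤ) : R) *
        M (i k (u 0)) (i k (u 1)))]
    refine Finset.prod_congr rfl fun k _ => ?_
    have : (Finset.univ : Finset (Equiv.Perm (Fin 2))) = {1, Equiv.swap 0 1} := by decide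
    rw [this, Finset.sum_pair (by decide)]
    simp [sub_eq_add_neg]
  have hterm (σ : Equiv.Perm (Fin (2 * n))) (ρ : Equiv.Perm (Fin n)) :
      ∑ s : Fin n → Equiv.Perm (Fin 2), f (σ * wreathPerm ρ s) =
        ((Equiv.Perm.sign σ : ℤ) : R) *
          ∏ k : Fin n, (M - M.transpose) (σ (pairFst k)) (σ (pairSnd k)) := by
    rw [← Equiv.prod_comp ρ (fun k => (M - M.transpose) (σ (pairFst k)) (σ (pairSnd k)))]
    simp only [← pairIndex_zero, ← pairIndex_one]
    rw [← hpair (fun k c => σ (pairIndex n (ρ k, c))), Finset.mul_sum]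
    refine Finset.sum_congr rfl fun s _ => ?_
    simp only [hf, ← pairIndex_zero, ← pairIndex_one, Equiv.Perm.mul_apply, wreathPerm_apply,
      Equiv.Perm.sign_mul, sign_wreathPerm, Finset.prod_mul_distrib]
    push_cast
    ring
  calc ∑ σ, f σ
      = ∑ σ, ∑ h : Equiv.Perm (Fin n) × (Fin n → Equiv.Perm (Fin 2)),
          if σ * (wreathPerm h.1 h.2)⁻¹ ∈ pairings n then f σ else 0 := by
        refine Finset.sum_congr rfl fun σ _ => ?_
        obtain ⟨h, hh, hu⟩ := existsUnique_mul_wreathPerm_inv_mem_pairings σ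
        rw [Finset.sum_eq_single h (fun h' _ hne => if_neg fun hm => hne (hu h' hm)) (by simp),
          if_pos hh]
    _ = ∑ h : Equiv.Perm (Fin n) × (Fin n → Equiv.Perm (Fin 2)), ∑ σ ∈ pairings n,
          f (σ * wreathPerm h.1 h.2) := by
        rw [Finset.sum_comm]
        refine Finset.sum_congr rfl fun h _ => ?_
        rw [← Equiv.sum_comp (Equiv.mulRight (wreathPerm h.1 h.2))]
        simp
    _ = ∑ ρ : Equiv.Perm (Fin n), ∑ σ ∈ pairings n,
          ∑ s : Fin n → Equiv.Perm (Fin 2), f (σ * wreathPerm ρ s) := by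
        rw [Fintype.sum_prod_type]
        exact Finset.sum_congr rfl fun ρ _ => Finset.sum_comm
    _ = n.factorial * pfaffian (M - M.transpose) := by
        simp only [hterm, pfaffian, Finset.sum_const, Finset.card_univ, Fintype.card_perm,
          Fintype.card_fin, nsmul_eq_mul]

/-! ### Alternating sums and staircase determinants -/

/-- The permutation of the `2n` indices that acts by `σ` on the first members of the pairs
and by `τ` on the second ones. -/
def columnPerm {n : ℕ} (σ τ : Equiv.Perm (Fin n)) : Equiv.Perm (Fin (2 * n)) :=
  (pairIndex n).permCongr (Equiv.prodCongrLeft ![σ, τ])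

@[simp] lemma columnPerm_pairFst {n : ℕ} (σ τ : Equiv.Perm (Fin n)) (k : Fin n) :
    columnPerm σ τ (pairFst k) = pairFst (σ k) := by
  simp [columnPerm, pairIndex_symm_pairFst, Equiv.prodCongrLeft]

@[simp] lemma columnPerm_pairSnd {n : ℕ} (σ τ : Equiv.Perm (Fin n)) (k : Fin n) :
    columnPerm σ τ (pairSnd k) = pairSnd (τ k) := by
  simp [columnPerm, pairIndex_symm_pairSnd, Equiv.prodCongrLeft]

@[simp] lemma sign_columnPerm {n : ℕ} (σ τ : Equiv.Perm (Fin n)) :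
    Equiv.Perm.sign (columnPerm σ τ) = Equiv.Perm.sign σ * Equiv.Perm.sign τ := by
  rw [columnPerm, Equiv.Perm.sign_permCongr, Equiv.Perm.sign_prodCongrLeft]
  simp [Fin.prod_univ_two]

section Staircase

variable {R α : Type*} [CommRing R] [LinearOrder α] {n : ℕ}

/-- The zero-one matrix with entry `1` at `(i, j)` exactly when `p i < q j`. -/
def comparisonMatrix (R : Type*) [CommRing R] (p q : Fin n → α) : Matrix (Fin n) (Fin n) R :=
  Matrix.of fun i j => if p i < q j then 1 else 0

/-- For sorted `p` and `q` the comparison matrix is a staircase: it is singular, with a zero row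
or two equal rows, unless `p` and `q` interlace, in which case it is unitriangular. -/
lemma det_comparisonMatrix_of_strictMono {p q : Fin n → α} (hp : StrictMono p)
    (hq : StrictMono q) :
    (comparisonMatrix R p q).det = if ∀ i j, p i < q j ↔ i ≤ j then 1 else 0 := by
  classical
  split_ifs with h
  · rw [Matrix.det_of_isUpperTriangular]
    · simp [comparisonMatrix, h]
    · intro i j hij
      exact if_neg fun hlt => absurd ((h i j).1 hlt) (not_le.2 hij)
  · by_contra hdet
    refine h ?_
    -- the row of `p i` is determined by the number `c i` of its zeros
    set S : Fin n → Finset (Fin n) := fun i => Finset.univ.filter fun j => q j ≤ p i with hS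
    have hmono : ∀ i i', i ≤ i' → S i ⊆ S i' := fun i i' hi j hj => by
      simp only [hS, Finset.mem_filter, Finset.mem_univ, true_and] at hj ⊢
      exact hj.trans (hp.monotone hi)
    have hlt (i : Fin n) : (S i).card < n := by
      refine lt_of_le_of_ne (by simpa using (S i).card_le_univ) fun hc => hdet ?_
      have hu : S i = Finset.univ := Finset.eq_univ_of_card _ (by simpa using hc)
      refine Matrix.det_eq_zero_of_row_eq_zero i fun j => ?_
      have : j ∈ S i := by simp [hu]
      simp only [hS, Finset.mem_filter, Finset.mem_univ, true_and] at this
      simp [comparisonMatrix, this]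
    have hstrict : StrictMono fun i => (⟨(S i).card, hlt i⟩ : Fin n) := by
      intro i i' hi
      refine Finset.card_lt_card ((hmono i i' hi.le).ssubset_of_ne fun he => hdet ?_)
      refine Matrix.det_zero_of_row_eq hi.ne (funext fun j => ?_)
      have := Finset.ext_iff.1 he j
      simp only [hS, Finset.mem_filter, Finset.mem_univ, true_and] at this
      simp [comparisonMatrix, ← not_le, this]
    have hcard (i : Fin n) : (S i).card = i := by
      have hid : (fun i => (⟨(S i).card, hlt i⟩ : Fin n)) = id := by
        rw [← hstrict.range_inj strictMono_id,
          (Finite.injective_iff_surjective.1 hstrict.injective).range_eq, Set.range_id]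
      exact congrArg Fin.val (congrFun hid i)
    -- `S i` is an initial segment, so it is `{j | j < i}`
    intro i j
    rw [← not_iff_not, not_lt, not_le]
    constructor
    · intro hj
      have : Finset.Iic j ⊆ S i := fun l hl => by
        simp only [hS, Finset.mem_filter, Finset.mem_univ, true_and]
        exact (hq.monotone (Finset.mem_Iic.1 hl)).trans hj
      have := Finset.card_le_card this
      rw [Fin.card_Iic, hcard] at this
      exact Fin.lt_def.2 this
    · intro hj
      by_contra hn
      have : S i ⊆ Finset.Iio j := fun l hl => by
        simp only [hS, Finset.mem_filter, Finset.mem_univ, true_and] at hl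
        exact Finset.mem_Iio.2 (hq.lt_iff_lt.1 (hl.trans_lt (not_le.1 hn)))
      have := Finset.card_le_card this
      rw [Fin.card_Iio, hcard] at this
      exact absurd (Fin.lt_def.1 hj) (not_lt.2 this)

lemma pairFst_lt_pairSnd_iff {i j : Fin n} : pairFst i < pairSnd j ↔ i ≤ j := by
  simp only [Fin.lt_def, Fin.le_def, pairFst, pairSnd]; omega

lemma pairSnd_lt_pairFst_iff {i j : Fin n} : pairSnd i < pairFst j ↔ i < j := by
  simp only [Fin.lt_def, pairFst, pairSnd]; omega

lemma pairFst_lt_pairFst_iff {i j : Fin n} : pairFst i < pairFst j ↔ i < j := by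
  simp only [Fin.lt_def, pairFst]; omega

lemma pairSnd_lt_pairSnd_iff {i j : Fin n} : pairSnd i < pairSnd j ↔ i < j := by
  simp only [Fin.lt_def, pairSnd]; omega

lemma strictMono_iff_interlacing {x : Fin (2 * n) → α} (hx : Function.Injective x)
    (hp : StrictMono fun k => x (pairFst k)) (hq : StrictMono fun k => x (pairSnd k)) :
    StrictMono x ↔ ∀ i j : Fin n, x (pairFst i) < x (pairSnd j) ↔ i ≤ j := by
  refine ⟨fun h i j => h.lt_iff_lt.trans pairFst_lt_pairSnd_iff, fun h => ?_⟩
  have : ∀ a b, a < b → x a < x b := by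
    rw [forall_index_iff]
    refine ⟨fun i => ?_, fun i => ?_⟩
    · rw [forall_index_iff]
      exact ⟨fun j hij => hp (pairFst_lt_pairFst_iff.1 hij),
        fun j hij => (h i j).2 (pairFst_lt_pairSnd_iff.1 hij)⟩
    · rw [forall_index_iff]
      refine ⟨fun j hij => ?_, fun j hij => hq (pairSnd_lt_pairSnd_iff.1 hij)⟩
      refine lt_of_le_of_ne (not_lt.1 fun hlt => ?_) (hx.ne hij.ne)
      exact absurd ((h j i).1 hlt) (not_le.2 (pairSnd_lt_pairFst_iff.1 hij))
  exact fun a b hab => this a b hab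

/-- The alternating sum over all rearrangements of `w`, separately in the first and in the second
members of the pairs. -/
def alternatingSum (w : (Fin (2 * n) → α) → R) (x : Fin (2 * n) → α) : R :=
  ∑ σ : Equiv.Perm (Fin n), ∑ τ : Equiv.Perm (Fin n),
    ((Equiv.Perm.sign σ : ℤ) : R) * ((Equiv.Perm.sign τ : ℤ) : R) * w (x ∘ columnPerm σ τ)

lemma sign_mul_self_cast {ι : Type*} [Fintype ι] [DecidableEq ι] (σ : Equiv.Perm ι) :
    ((Equiv.Perm.sign σ : ℤ) : R) * ((Equiv.Perm.sign σ : ℤ) : R) = 1 := by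
  rw [← Int.cast_mul, ← Units.val_mul, Int.units_mul_self]; simp

/-- The indicator function of the region where every pair is in increasing order. -/
def pairsOrdered (R : Type*) [CommRing R] (x : Fin (2 * n) → α) : R :=
  ∏ k : Fin n, if x (pairFst k) < x (pairSnd k) then 1 else 0

open Classical in
/-- The indicator function of the region where all coordinates are in increasing order. -/
noncomputable def allOrdered (R : Type*) [CommRing R] (x : Fin (2 * n) → α) : R :=
  if StrictMono x then 1 else 0

lemma alternatingSum_pairsOrdered (x : Fin (2 * n) → α) :
    alternatingSum (pairsOrdered R) x =
      n.factorial * (comparisonMatrix R (fun k => x (pairFst k)) fun k => x (pairSnd k)).det := by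
  set N := comparisonMatrix R (fun k => x (pairFst k)) fun k => x (pairSnd k) with hN
  have h (σ : Equiv.Perm (Fin n)) : ∑ τ : Equiv.Perm (Fin n),
      ((Equiv.Perm.sign σ : ℤ) : R) * ((Equiv.Perm.sign τ : ℤ) : R) *
        pairsOrdered R (x ∘ columnPerm σ τ) = N.det := by
    calc _ = ((Equiv.Perm.sign σ : ℤ) : R) * (N.submatrix σ id).transpose.det := by
          rw [Matrix.det_apply', Finset.mul_sum]
          refine Finset.sum_congr rfl fun τ _ => ?_
          simp [hN, pairsOrdered, comparisonMatrix, mul_assoc]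
      _ = N.det := by
          rw [Matrix.det_transpose, Matrix.det_permute, ← mul_assoc, sign_mul_self_cast, one_mul]
  simp only [alternatingSum, h, Finset.sum_const, Finset.card_univ, Fintype.card_perm,
    Fintype.card_fin, nsmul_eq_mul]

lemma alternatingSum_allOrdered {x : Fin (2 * n) → α} (hx : Function.Injective x) :
    alternatingSum (allOrdered R) x =
      (comparisonMatrix R (fun k => x (pairFst k)) fun k => x (pairSnd k)).det := by
  classical
  have hF : Function.Injective fun k : Fin n => x (pairFst k) := fun i j h => by
    have := hx h
    simp only [pairFst, Fin.mk.injEq] at this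
    ext; omega
  have hS : Function.Injective fun k : Fin n => x (pairSnd k) := fun i j h => by
    have := hx h
    simp only [pairSnd, Fin.mk.injEq] at this
    ext; omega
  -- only the rearrangement sorting both halves contributes
  obtain ⟨σ, hσ, hσ'⟩ := existsUnique_strictMono_comp hF
  obtain ⟨τ, hτ, hτ'⟩ := existsUnique_strictMono_comp hS
  have hz (σ₁ τ₁ : Equiv.Perm (Fin n)) (h : StrictMono (x ∘ columnPerm σ₁ τ₁)) :
      σ₁ = σ ∧ τ₁ = τ := by
    refine ⟨hσ' _ fun i j hij => ?_, hτ' _ fun i j hij => ?_⟩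
    · simpa using h (pairFst_lt_pairFst_iff.2 hij)
    · simpa using h (pairSnd_lt_pairSnd_iff.2 hij)
  have hsum : alternatingSum (allOrdered R) x =
      ((Equiv.Perm.sign σ : ℤ) : R) * ((Equiv.Perm.sign τ : ℤ) : R) *
        allOrdered R (x ∘ columnPerm σ τ) := by
    rw [alternatingSum, Finset.sum_eq_single σ _ (by simp), Finset.sum_eq_single τ _ (by simp)]
    · intro τ₁ _ hne
      rw [allOrdered, if_neg fun h => hne (hz _ _ h).2, mul_zero]
    · intro σ₁ _ hne
      refine Finset.sum_eq_zero fun τ₁ _ => ?_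
      rw [allOrdered, if_neg fun h => hne (hz _ _ h).1, mul_zero]
  have hdet : allOrdered R (x ∘ columnPerm σ τ) =
      ((comparisonMatrix R (fun k => x (pairFst k)) fun k => x (pairSnd k)).submatrix σ τ).det := by
    have h1 := det_comparisonMatrix_of_strictMono (R := R) hσ hτ
    have h2 := strictMono_iff_interlacing (x := x ∘ columnPerm σ τ) (hx.comp (Equiv.injective _))
      (by simpa [Function.comp_def] using hσ) (by simpa [Function.comp_def] using hτ)
    simp only [allOrdered, h2]
    simp only [Function.comp_apply, columnPerm_pairFst, columnPerm_pairSnd]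
    exact h1.symm
  have hperm (N : Matrix (Fin n) (Fin n) R) : (N.submatrix σ τ).det =
      ((Equiv.Perm.sign σ : ℤ) : R) * (((Equiv.Perm.sign τ : ℤ) : R) * N.det) := by
    rw [← Matrix.det_permute', ← Matrix.det_permute]
    rfl
  rw [hsum, hdet, hperm]
  linear_combination
    (comparisonMatrix R (fun k => x (pairFst k)) fun k => x (pairSnd k)).det *
      (((Equiv.Perm.sign τ : ℤ) : R) * ((Equiv.Perm.sign τ : ℤ) : R) *
        sign_mul_self_cast (R := R) σ + sign_mul_self_cast (R := R) τ)

/-- Once antisymmetrised, ordering within the pairs and ordering all coordinates are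
proportional. -/
lemma alternatingSum_pairsOrdered_eq {x : Fin (2 * n) → α} (hx : Function.Injective x) :
    alternatingSum (pairsOrdered R) x = n.factorial * alternatingSum (allOrdered R) x := by
  rw [alternatingSum_pairsOrdered, alternatingSum_allOrdered hx]

end Staircase

/-! ### Integration over alternating determinants -/

section Measure

variable {K : Type*} [RCLike K] {n : ℕ} {μ : Measure ℝ} [SigmaFinite μ]

/-- Almost every point has distinct coordinates when the measure has no atoms. -/
lemma ae_injective_pi [NullSingletonClass μ] (m : ℕ) :
    ∀ᵐ x ∂Measure.pi fun _ : Fin m => μ, Function.Injective x := by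
  have key (i j : Fin m) (hij : j ≠ i) : ∀ᵐ x ∂Measure.pi fun _ : Fin m => μ, x i ≠ x j := by
    obtain _ | m := m
    · exact i.elim0
    obtain ⟨l, rfl⟩ := Fin.exists_succAbove_eq hij
    have hmp := measurePreserving_piFinSuccAbove (fun _ : Fin (m + 1) => μ) i
    have h0 : ∀ᵐ p ∂μ.prod (Measure.pi fun _ : Fin m => μ), p.1 ≠ p.2 l := by
      have hms : MeasurableSet {p : ℝ × (Fin m → ℝ) | p.1 = p.2 l} :=
        measurableSet_eq_fun measurable_fst ((measurable_pi_apply l).comp measurable_snd)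
      simp only [ae_iff, ne_eq, not_not]
      rw [Measure.measure_prod_null hms]
      refine Filter.Eventually.of_forall fun t => ?_
      simpa [eq_comm] using Measure.pi_hyperplane (fun _ : Fin m => μ) l t
    exact hmp.quasiMeasurePreserving.ae h0
  have hall : ∀ᵐ x ∂Measure.pi fun _ : Fin m => μ, ∀ i j : Fin m, j ≠ i → x i ≠ x j := by
    rw [ae_all_iff]; intro i
    rw [ae_all_iff]; intro j
    by_cases hij : j = i
    · simp [hij]
    · filter_upwards [key i j hij] with x hx _ using hx
  filter_upwards [hall] with x hx i j hxij
  by_contra hne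
  exact hx i j (Ne.symm hne) hxij

/-- Permuting the coordinates, as a measurable equivalence. -/
def permCoordinates {m : ℕ} (π : Equiv.Perm (Fin m)) : (Fin m → ℝ) ≃ᵐ (Fin m → ℝ) :=
  MeasurableEquiv.piCongrLeft (fun _ => ℝ) π.symm

lemma permCoordinates_apply {m : ℕ} (π : Equiv.Perm (Fin m)) (x : Fin m → ℝ) :
    permCoordinates π x = x ∘ π := by
  funext i
  obtain ⟨j, rfl⟩ := π.symm.surjective i
  rw [permCoordinates, MeasurableEquiv.coe_piCongrLeft, Equiv.piCongrLeft_apply_apply]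
  simp

lemma measurePreserving_permCoordinates {m : ℕ} (π : Equiv.Perm (Fin m)) :
    MeasurePreserving (permCoordinates π) (Measure.pi fun _ => μ) (Measure.pi fun _ => μ) :=
  measurePreserving_piCongrLeft (fun _ => μ) π.symm

/-- Integrating against a function alternating in both halves of the pairs, a weight may be
replaced by its alternating sum. -/
lemma integral_mul_alternatingSum {D w : (Fin (2 * n) → ℝ) → K}
    (hD : ∀ (σ τ : Equiv.Perm (Fin n)) x, D (x ∘ columnPerm σ τ) =
      ((Equiv.Perm.sign σ : ℤ) : K) * ((Equiv.Perm.sign τ : ℤ) : K) * D x)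
    (hint : Integrable (fun x => D x * w x) (Measure.pi fun _ => μ)) :
    ∫ x, D x * alternatingSum w x ∂Measure.pi (fun _ => μ) =
      (n.factorial : K) * (n.factorial * ∫ x, D x * w x ∂Measure.pi fun _ => μ) := by
  have hswap (σ τ : Equiv.Perm (Fin n)) (x : Fin (2 * n) → ℝ) :
      D x * (((Equiv.Perm.sign σ : ℤ) : K) * ((Equiv.Perm.sign τ : ℤ) : K) *
        w (x ∘ columnPerm σ τ)) =
      (fun x => D x * w x) (permCoordinates (columnPerm σ τ) x) := by
    simp only [permCoordinates_apply, hD]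
    ring
  have hint' (σ τ : Equiv.Perm (Fin n)) :
      Integrable (fun x => (fun x => D x * w x) (permCoordinates (columnPerm σ τ) x))
        (Measure.pi fun _ => μ) :=
    ((measurePreserving_permCoordinates (columnPerm σ τ)).integrable_comp_emb
      (MeasurableEquiv.measurableEmbedding _)).2 hint
  simp only [alternatingSum, Finset.mul_sum, hswap]
  rw [integral_finsetSum _ fun σ _ => integrable_finsetSum _ fun τ _ => hint' σ τ]
  simp_rw [integral_finsetSum _ fun τ _ => hint' _ τ,
    (measurePreserving_permCoordinates _).integral_comp' fun x => D x * w x]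
  simp [Fintype.card_perm]

/-- Gluing `n` points of the plane to a point of `ℝ²ⁿ`. -/
def gluePairs (n : ℕ) (y : Fin n → ℝ × ℝ) : Fin (2 * n) → ℝ := fun i =>
  if ((pairIndex n).symm i).2 = 0 then (y ((pairIndex n).symm i).1).1
  else (y ((pairIndex n).symm i).1).2

@[simp] lemma gluePairs_pairFst (y : Fin n → ℝ × ℝ) (k : Fin n) :
    gluePairs n y (pairFst k) = (y k).1 := by
  simp [gluePairs, pairIndex_symm_pairFst]

@[simp] lemma gluePairs_pairSnd (y : Fin n → ℝ × ℝ) (k : Fin n) :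
    gluePairs n y (pairSnd k) = (y k).2 := by
  simp [gluePairs, pairIndex_symm_pairSnd]

lemma measurable_gluePairs : Measurable (gluePairs n) := by
  refine measurable_pi_iff.2 ?_
  rw [forall_index_iff]
  constructor <;> intro k <;> simp only [gluePairs_pairFst, gluePairs_pairSnd] <;> fun_prop

lemma measurePreserving_gluePairs :
    MeasurePreserving (gluePairs n) (Measure.pi fun _ => μ.prod μ) (Measure.pi fun _ => μ) := by
  refine ⟨measurable_gluePairs, (Measure.pi_eq fun s hs => ?_).symm⟩
  rw [Measure.map_apply measurable_gluePairs (MeasurableSet.univ_pi hs)]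
  have : gluePairs n ⁻¹' Set.univ.pi s =
      Set.univ.pi fun k => s (pairFst k) ×ˢ s (pairSnd k) := by
    ext y
    simp only [Set.mem_preimage, Set.mem_univ_pi, Set.mem_prod]
    rw [forall_index_iff]
    simp [forall_and]
  rw [this, Measure.pi_pi, prod_univ_eq_prod_pairs]
  simp [Measure.prod_prod]

lemma even_val_pairFst (k : Fin n) : Even (pairFst k : ℕ) := ⟨k, by simp [pairFst]; ring⟩

lemma not_even_val_pairSnd (k : Fin n) : ¬ Even (pairSnd k : ℕ) := by
  simp [pairSnd, parity_simps]

lemma alternatingMatrix_pairFst {L : Type*} (φ ψ : Fin (2 * n) → ℝ → L) (x : Fin (2 * n) → ℝ)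
    (i : Fin (2 * n)) (k : Fin n) :
    alternatingMatrix φ ψ x i (pairFst k) = φ i (x (pairFst k)) :=
  if_pos (even_val_pairFst k)

lemma alternatingMatrix_pairSnd {L : Type*} (φ ψ : Fin (2 * n) → ℝ → L) (x : Fin (2 * n) → ℝ)
    (i : Fin (2 * n)) (k : Fin n) :
    alternatingMatrix φ ψ x i (pairSnd k) = ψ i (x (pairSnd k)) :=
  if_neg (not_even_val_pairSnd k)

lemma det_alternatingMatrix (φ ψ : Fin (2 * n) → ℝ → K) (x : Fin (2 * n) → ℝ) :
    (alternatingMatrix φ ψ x).det = ∑ σ : Equiv.Perm (Fin (2 * n)),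
      ((Equiv.Perm.sign σ : ℤ) : K) * ∏ k : Fin n,
        (φ (σ (pairFst k)) (x (pairFst k)) * ψ (σ (pairSnd k)) (x (pairSnd k))) := by
  simp only [Matrix.det_apply', prod_univ_eq_prod_pairs, alternatingMatrix_pairFst,
    alternatingMatrix_pairSnd]

lemma det_alternatingMatrix_comp_columnPerm (φ ψ : Fin (2 * n) → ℝ → K)
    (σ τ : Equiv.Perm (Fin n)) (x : Fin (2 * n) → ℝ) :
    (alternatingMatrix φ ψ (x ∘ columnPerm σ τ)).det =
      ((Equiv.Perm.sign σ : ℤ) : K) * ((Equiv.Perm.sign τ : ℤ) : K) *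
        (alternatingMatrix φ ψ x).det := by
  have : alternatingMatrix φ ψ (x ∘ columnPerm σ τ) =
      (alternatingMatrix φ ψ x).submatrix id (columnPerm σ τ) := by
    ext i j
    revert j
    rw [forall_index_iff]
    simp [alternatingMatrix_pairFst, alternatingMatrix_pairSnd]
  rw [this, Matrix.det_permute', sign_columnPerm]
  push_cast
  ring

lemma integrable_det_alternatingMatrix {φ ψ : Fin (2 * n) → ℝ → K}
    (hφ : ∀ i, Integrable (φ i) μ) (hψ : ∀ i, Integrable (ψ i) μ) :
    Integrable (fun x => (alternatingMatrix φ ψ x).det) (Measure.pi fun _ => μ) := by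
  simp only [Matrix.det_apply']
  refine integrable_finsetSum _ fun σ _ => Integrable.const_mul ?_ _
  refine Integrable.fintype_prod
    (f := fun (j : Fin (2 * n)) t => if Even (j : ℕ) then φ (σ j) t else ψ (σ j) t) fun j => ?_
  split_ifs
  · exact hφ _
  · exact hψ _

/-- The triangular integrals `∬_{x < y} φᵢ(x) ψⱼ(y) dμ(x) dμ(y)`. -/
noncomputable def triangleIntegralMatrix (μ : Measure ℝ) (φ ψ : Fin (2 * n) → ℝ → K) :
    Matrix (Fin (2 * n)) (Fin (2 * n)) K :=
  Matrix.of fun i j => ∫ p in {p : ℝ × ℝ | p.1 < p.2}, φ i p.1 * ψ j p.2 ∂μ.prod μ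

lemma measurableSet_fst_lt_snd : MeasurableSet {p : ℝ × ℝ | p.1 < p.2} :=
  measurableSet_lt measurable_fst measurable_snd

lemma measurable_pairsOrdered : Measurable (pairsOrdered (n := n) (α := ℝ) K) := by
  unfold pairsOrdered
  refine Finset.measurable_fun_prod _ fun k _ => ?_
  exact Measurable.ite (measurableSet_lt (measurable_pi_apply _) (measurable_pi_apply _))
    measurable_const measurable_const

lemma norm_pairsOrdered_le (x : Fin (2 * n) → ℝ) : ‖pairsOrdered K x‖ ≤ 1 := by
  rw [pairsOrdered, norm_prod]
  refine Finset.prod_le_one (fun _ _ => norm_nonneg _) fun k _ => ?_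
  split_ifs <;> simp

lemma measurableSet_strictMono (m : ℕ) : MeasurableSet {x : Fin m → ℝ | StrictMono x} := by
  simp only [StrictMono, Set.ofPred_forall]
  exact MeasurableSet.iInter fun i => MeasurableSet.iInter fun j => MeasurableSet.iInter fun _ =>
    measurableSet_lt (measurable_pi_apply _) (measurable_pi_apply _)

/-- With each pair ordered separately, the integral of the determinant splits into products of
double integrals. -/
lemma integral_det_mul_pairsOrdered {φ ψ : Fin (2 * n) → ℝ → K}
    (hφ : ∀ i, Integrable (φ i) μ) (hψ : ∀ i, Integrable (ψ i) μ) :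
    ∫ x, (alternatingMatrix φ ψ x).det * pairsOrdered K x ∂Measure.pi (fun _ => μ) =
      ∑ σ : Equiv.Perm (Fin (2 * n)), ((Equiv.Perm.sign σ : ℤ) : K) *
        ∏ k : Fin n, triangleIntegralMatrix μ φ ψ (σ (pairFst k)) (σ (pairSnd k)) := by
  have hint : Integrable (fun x => (alternatingMatrix φ ψ x).det * pairsOrdered K x)
      (Measure.pi fun _ => μ) :=
    (integrable_det_alternatingMatrix hφ hψ).mul_bdd
      measurable_pairsOrdered.aestronglyMeasurable (.of_forall norm_pairsOrdered_le)
  have hmp := measurePreserving_gluePairs (n := n) (μ := μ)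
  rw [← hmp.map_eq, integral_map measurable_gluePairs.aemeasurable
    (hmp.map_eq.symm ▸ hint.aestronglyMeasurable)]
  let g (i j : Fin (2 * n)) : ℝ × ℝ → K :=
    {p : ℝ × ℝ | p.1 < p.2}.indicator fun p => φ i p.1 * ψ j p.2
  have hg (i j : Fin (2 * n)) : Integrable (g i j) (μ.prod μ) :=
    ((hφ i).mul_prod (hψ j)).indicator measurableSet_fst_lt_snd
  have hsplit (y : Fin n → ℝ × ℝ) :
      (alternatingMatrix φ ψ (gluePairs n y)).det * pairsOrdered K (gluePairs n y) =
        ∑ σ : Equiv.Perm (Fin (2 * n)), ((Equiv.Perm.sign σ : ℤ) : K) *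
          ∏ k : Fin n, g (σ (pairFst k)) (σ (pairSnd k)) (y k) := by
    rw [det_alternatingMatrix, Finset.sum_mul]
    refine Finset.sum_congr rfl fun σ _ => ?_
    rw [mul_assoc, pairsOrdered, ← Finset.prod_mul_distrib]
    simp [g, Set.indicator_apply]
  simp only [hsplit]
  rw [integral_finsetSum _ fun σ _ => Integrable.const_mul
    (Integrable.fintype_prod fun k => hg (σ (pairFst k)) (σ (pairSnd k))) _]
  refine Finset.sum_congr rfl fun σ _ => ?_
  rw [integral_const_mul, integral_fintype_prod_eq_prod
    (fun k => g (σ (pairFst k)) (σ (pairSnd k)))]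
  simp [g, triangleIntegralMatrix, integral_indicator measurableSet_fst_lt_snd]

/-- De Bruijn's formula for a measure without atoms on the line. -/
theorem integral_det_alternatingMatrix_strictMono [NullSingletonClass μ]
    {φ ψ : Fin (2 * n) → ℝ → K}
    (hφ : ∀ i, Integrable (φ i) μ) (hψ : ∀ i, Integrable (ψ i) μ) :
    ∫ x in {x | StrictMono x}, (alternatingMatrix φ ψ x).det ∂Measure.pi (fun _ => μ) =
      pfaffian (triangleIntegralMatrix μ φ ψ - (triangleIntegralMatrix μ φ ψ).transpose) := by
  classical
  have hfac : (n.factorial : K) ≠ 0 := Nat.cast_ne_zero.2 n.factorial_ne_zero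
  have hD := integrable_det_alternatingMatrix hφ hψ
  have hall (x : Fin (2 * n) → ℝ) : (alternatingMatrix φ ψ x).det * allOrdered K x =
      {x | StrictMono x}.indicator (fun x => (alternatingMatrix φ ψ x).det) x := by
    simp [allOrdered, Set.indicator_apply]
  have hint₁ : Integrable (fun x => (alternatingMatrix φ ψ x).det * pairsOrdered K x)
      (Measure.pi fun _ => μ) :=
    hD.mul_bdd measurable_pairsOrdered.aestronglyMeasurable (.of_forall norm_pairsOrdered_le)
  have hint₂ : Integrable (fun x => (alternatingMatrix φ ψ x).det * allOrdered K x)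
      (Measure.pi fun _ => μ) := by
    simp only [hall]
    exact hD.indicator (measurableSet_strictMono _)
  have h₁ := integral_mul_alternatingSum (det_alternatingMatrix_comp_columnPerm φ ψ) hint₁
  have h₂ := integral_mul_alternatingSum (det_alternatingMatrix_comp_columnPerm φ ψ) hint₂
  have h₃ : ∫ x, (alternatingMatrix φ ψ x).det * alternatingSum (pairsOrdered K) x
        ∂Measure.pi (fun _ => μ) =
      n.factorial * ∫ x, (alternatingMatrix φ ψ x).det * alternatingSum (allOrdered K) x
        ∂Measure.pi (fun _ => μ) := by
    rw [← integral_const_mul]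
    refine integral_congr_ae ?_
    filter_upwards [ae_injective_pi (μ := μ) (2 * n)] with x hx
    rw [alternatingSum_pairsOrdered_eq hx]
    ring
  rw [h₁, h₂, integral_det_mul_pairsOrdered hφ hψ, sum_sign_mul_prod_pairs_eq] at h₃
  simp only [hall, integral_indicator (measurableSet_strictMono _)] at h₃
  -- two factors `n!` come from the symmetrisation, the third from `n! * pfaffian`
  exact (mul_left_cancel₀ hfac (mul_left_cancel₀ hfac (mul_left_cancel₀ hfac h₃))).symm

/-! ### Lebesgue measure on an interval -/

lemma restrict_orderedDomain (a b : EReal) (m : ℕ) :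
    (volume : Measure (Fin m → ℝ)).restrict (orderedDomain a b m) =
      (Measure.pi fun _ => (volume : Measure ℝ).restrict (realInterval a b)).restrict
        {x | StrictMono x} := by
  rw [← Measure.restrict_pi_pi, Measure.restrict_restrict (measurableSet_strictMono m), ← volume_pi]
  congr 1
  ext x
  simp [orderedDomain]

lemma restrict_triangleDomain (a b : EReal) :
    (volume : Measure (ℝ × ℝ)).restrict (triangleDomain a b) =
      (((volume : Measure ℝ).restrict (realInterval a b)).prod
        ((volume : Measure ℝ).restrict (realInterval a b))).restrict {p | p.1 < p.2} := by
  rw [Measure.prod_restrict, Measure.restrict_restrict measurableSet_fst_lt_snd,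
    ← Measure.volume_eq_prod]
  congr 1
  ext p
  simp only [triangleDomain, Set.mem_ofPred_eq, Set.mem_inter_iff, Set.mem_prod]
  tauto

end Measure

theorem mainTheorem4 {K : Type*} [RCLike K] (n : ℕ) (a b : EReal)
    (φ ψ : Fin (2 * n) → ℝ → K)
    (hφ : ∀ i, IntegrableOn (φ i) (realInterval a b))
    (hψ : ∀ i, IntegrableOn (ψ i) (realInterval a b)) :
    IntegrableOn (fun x : Fin (2 * n) → ℝ => (alternatingMatrix φ ψ x).det)
        (orderedDomain a b (2 * n)) ∧
      (∀ i j, IntegrableOn (fun p : ℝ × ℝ => φ i p.1 * ψ j p.2 - φ j p.1 * ψ i p.2)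
        (triangleDomain a b)) ∧
      ∫ x in orderedDomain a b (2 * n), (alternatingMatrix φ ψ x).det =
        pfaffian (pairIntegralMatrix a b φ ψ) := by
  have hφψ (i j) := (((hφ i).mul_prod (hψ j)).restrict (s := {p : ℝ × ℝ | p.1 < p.2}))
  refine ⟨?_, fun i j => ?_, ?_⟩
  · rw [IntegrableOn, restrict_orderedDomain]
    exact (integrable_det_alternatingMatrix hφ hψ).restrict
  · rw [IntegrableOn, restrict_triangleDomain]
    exact (hφψ i j).sub (hφψ j i)
  · rw [restrict_orderedDomain, integral_det_alternatingMatrix_strictMono hφ hψ]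
    congr 1
    ext i j
    simp only [pairIntegralMatrix, triangleIntegralMatrix, Matrix.of_apply, Matrix.sub_apply,
      Matrix.transpose_apply, restrict_triangleDomain]
    exact (integral_sub (hφψ i j) (hφψ j i)).symm
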